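/- Let $A$ be a finite set of items and let $\mathcal F$ be an antimonotonic family of subsets of $A$ (itemsets): every subset of a member of $\mathcal F$ is a member of $\mathcal F$. A distribution $p$ on $\{0,1\}^A$ satisfies frequencies $\theta=(\theta_U)_{U\in\mathcal F}$ if $p(z_a=1\text{ for all }a\in U)=\theta_U$ for all $U\in\mathcal F$; frequencies $\theta$ for $\mathcal F$ are vectors satisfied by at least one distribution on $\{0,1\}^A$. A set $C\subseteq A$ is *safe* if, for all frequencies $\theta$ for $\mathcal F$, every distribution on $\{0,1\}^C$ that satisfies the restriction of $\theta$ to $\{U\in\mathcal F: U\subseteq C\}$ is the marginal on $C$ of some distribution on $\{0,1\}^A$ satisfying $\theta$. Let $G$ be the graph on $A$ in which distinct $a,b$ are adjacent iff $\{a,b\}\in\mathcal F$. For $x\in A$, $C\subseteq A$ and $r\ge 0$ let $N_r(x\mid C)$ be the set of items reachable from $x$ by a path of length at most $r$ in $G$ of which only the last item may belong to $C$. The *rank* of $x$ with respect to $C$ is the vector $(v_1,\dots,v_{|A|-1})$ with $v_i=|C\cap(N_i(x\mid C)\setminus N_{i-1}(x\mid C))|$; ranks are compared lexicographically. Given $B\subseteq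 A$, the algorithm computes $\mathrm{safe}(B,\mathcal F)$ as follows. Start with $C:=B$ and repeat the following. Let $V$ be the set of the items outside $C$ that have a neighbour in $C$. For $r=1,2,\dots$ compute $U_x:=N_r(x\mid C)\cap C$ for all $x\in V$; stop at the first $r$ for which either some $U_x\notin\mathcal F$ (a violation) or no $U_x$ changes any more, that is, $N_{r'}(x\mid C)\cap C=N_r(x\mid C)\cap C$ for all $x\in V$ and $r'\ge r$. If there is a violation, let $W:=\{x\in V: U_x\notin\mathcal F\}$, add to $C$ all the items of $W$ whose rank with respect to $C$ is the largest one in $W$, and repeat. If there is none, output $C$. Then, for every $B\subseteq A$, the algorithm terminates and its output $\mathrm{safe}(B,\mathcal F)$ is a safe set containing $B$ of minimum cardinality among the safe sets containing $B$. It is the only safe set containing $B$ of that cardinality, and it is contained in every safe set containing $B$. -/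

import Mathlib

namespace SafeProjection

/-! ### Itemsets, frequencies and distributions

Items are the elements of a finite type `A`; an itemset is a `Finset A`; a distribution on
`{0,1}^A` is an element of `stdSimplex ℝ (A → Bool)`. -/

section Distributions

variable {A : Type*}

/-- The family contains every subset of each of its members. -/
def Antimonotonic (F : Finset (Finset A)) : Prop :=
  ∀ U ∈ F, ∀ V : Finset A, V ⊆ U → V ∈ F

/-- The itemset indicator function `S_U : {0,1}^A → {0,1}`. -/
def indicator (U : Finset A) (z : A → Bool) : ℝ :=
  if ∀ a ∈ U, z a = true then 1 else 0

/-- The mean of `S_U` under `p`. -/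
def mean [Fintype A] [DecidableEq A] (p : (A → Bool) → ℝ) (U : Finset A) : ℝ :=
  ∑ z, p z * indicator U z

/-- `p` satisfies the frequencies `θ` for the family `F`. Only the values of `θ` on `F` matter. -/
def Satisfies [Fintype A] [DecidableEq A] (F : Finset (Finset A)) (θ : Finset A → ℝ)
    (p : (A → Bool) → ℝ) : Prop :=
  ∀ U ∈ F, mean p U = θ U

/-- `θ` is a vector of frequencies for `F`: it is realised by some distribution on `{0,1}^A`. -/
def Consistent [Fintype A] [DecidableEq A] (F : Finset (Finset A)) (θ : Finset A → ℝ) : Prop :=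
  ∃ p ∈ stdSimplex ℝ (A → Bool), Satisfies F θ p

/-- An itemset over the items of `C`, seen as an itemset over all items. -/
def liftItemset (C : Finset A) (U : Finset C) : Finset A :=
  U.map (Function.Embedding.subtype (· ∈ C))

/-- The projected family: the members of `F` contained in `C`, as itemsets over `C`. -/
def projFamily [DecidableEq A] (C : Finset A) (F : Finset (Finset A)) : Finset (Finset C) :=
  Finset.univ.filter fun U => liftItemset C U ∈ F

/-- The projected frequency vector. -/
def projFreq (C : Finset A) (θ : Finset A → ℝ) : Finset C → ℝ :=
  fun U => θ (liftItemset C U)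

/-- The marginal of `p` on the items of `C`. -/
def marginal [Fintype A] [DecidableEq A] (C : Finset A) (p : (A → Bool) → ℝ) :
    (C → Bool) → ℝ :=
  fun w => ∑ z ∈ Finset.univ.filter (fun z : A → Bool => ∀ a : C, z a = w a), p z

/-- `C` is `θ`-safe: each distribution on `C` with the projected frequencies extends to a
distribution on all items with the frequencies `θ`. -/
def ThetaSafe [Fintype A] [DecidableEq A] (F : Finset (Finset A)) (θ : Finset A → ℝ)
    (C : Finset A) : Prop :=
  ∀ q ∈ stdSimplex ℝ (C → Bool), Satisfies (projFamily C F) (projFreq C θ) q →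
    ∃ p ∈ stdSimplex ℝ (A → Bool), marginal C p = q ∧ Satisfies F θ p

/-- `C` is safe: it is `θ`-safe for all frequencies `θ` for `F`. -/
def IsSafe [Fintype A] [DecidableEq A] (F : Finset (Finset A)) (C : Finset A) : Prop :=
  ∀ θ : Finset A → ℝ, Consistent F θ → ThetaSafe F θ C

/-- `Y` is a safe set containing `B` of minimum cardinality. -/
def IsMinimumSafe [Fintype A] [DecidableEq A] (F : Finset (Finset A)) (B Y : Finset A) : Prop :=
  (B ⊆ Y ∧ IsSafe F Y) ∧ ∀ Y' : Finset A, B ⊆ Y' → IsSafe F Y' → Y.card ≤ Y'.card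

end Distributions

/-! ### The search algorithm -/

noncomputable section Algorithm

variable {A : Type*} [Fintype A] [DecidableEq A]

/-- The dependency graph: two distinct items are adjacent if the pair belongs to `F`. -/
def dependencyGraph (F : Finset (Finset A)) : SimpleGraph A where
  Adj a b := a ≠ b ∧ ({a, b} : Finset A) ∈ F
  symm := ⟨fun a b h => ⟨h.1.symm, Finset.pair_comm a b ▸ h.2⟩⟩
  loopless := ⟨fun _ h => h.1 rfl⟩

open Classical in
/-- The restricted neighbourhood of `x` of radius `r`: the items reachable from `x` by a path of
length at most `r` of which only the last item may belong to `C`. -/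
def restrictedNbhd (F : Finset (Finset A)) (C : Finset A) (x : A) (r : ℕ) : Finset A :=
  Finset.univ.filter fun y => ∃ P : (dependencyGraph F).Walk x y,
    P.IsPath ∧ P.length ≤ r ∧ ∀ z ∈ P.support, z ∈ C → z = y

/-- The rank of `x` with respect to `C`: a vector of length `|A| - 1`, ordered lexicographically,
whose entries (for `i = 1, …, |A| - 1`) count the items of `C` at restricted distance `i`. -/
def rank (F : Finset (Finset A)) (C : Finset A) (x : A) :
    Lex (Fin (Fintype.card A - 1) → ℕ) :=
  toLex fun i =>
    (C ∩ (restrictedNbhd F C x ((i : ℕ) + 1) \ restrictedNbhd F C x (i : ℕ))).card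

open Classical in
/-- The set `V` of the neighbours of `C`. -/
def neighbours (F : Finset (Finset A)) (C : Finset A) : Finset A :=
  (Finset.univ.filter fun x => ∃ y ∈ C, (dependencyGraph F).Adj x y) \ C

/-- The set `U_x` at search radius `r`. -/
def scan (F : Finset (Finset A)) (C : Finset A) (r : ℕ) (x : A) : Finset A :=
  restrictedNbhd F C x r ∩ C

/-- The set `W` of the violating items at search radius `r`. -/
def violators (F : Finset (Finset A)) (C : Finset A) (r : ℕ) : Finset A :=
  (neighbours F C).filter fun x => scan F C r x ∉ F

/-- From radius `r` on, no `U_x` changes any more. -/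
def Stable (F : Finset (Finset A)) (C : Finset A) (r : ℕ) : Prop :=
  ∀ x ∈ neighbours F C, ∀ r' : ℕ, r ≤ r' → scan F C r' x = scan F C r x

theorem stable_of_card_le (F : Finset (Finset A)) (C : Finset A) {r : ℕ}
    (h : Fintype.card A ≤ r) : Stable F C r := by
  intro x _ r' hr
  ext y
  simp only [scan, restrictedNbhd, Finset.mem_inter, Finset.mem_filter, Finset.mem_univ, true_and]
  refine and_congr_left fun _ => exists_congr fun P => and_congr_right fun hP => ?_
  have := hP.length_lt
  refine and_congr_left fun _ => ?_
  omega

open Classical in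
/-- The inner loop, entered at radius `r`: the radius is increased until a violation is found or no
`U_x` changes any more; the last radius is returned. -/
def innerLoop (F : Finset (Finset A)) (C : Finset A) (r : ℕ) : ℕ :=
  if h : (violators F C r).Nonempty ∨ Stable F C r then r
  else innerLoop F C (r + 1)
termination_by Fintype.card A - r
decreasing_by
  have : ¬ Fintype.card A ≤ r := fun hr => h (Or.inr (stable_of_card_le F C hr))
  omega

/-- The set `W` of the violating items after the inner loop, which starts at radius `1`. -/
def foundViolators (F : Finset (Finset A)) (C : Finset A) : Finset A :=
  violators F C (innerLoop F C 1)

open Classical in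
/-- The set `Z` of the found violating items of the largest rank. -/
def topViolators (F : Finset (Finset A)) (C : Finset A) : Finset A :=
  (foundViolators F C).filter fun x =>
    IsGreatest {v | ∃ y ∈ foundViolators F C, rank F C y = v} (rank F C x)

theorem card_lt_card_union_topViolators (F : Finset (Finset A)) (C : Finset A)
    (h : (foundViolators F C).Nonempty) : C.card < (C ∪ topViolators F C).card := by
  obtain ⟨x, hx, hmax⟩ := Finset.exists_max_image (foundViolators F C) (rank F C) h
  have hxC : x ∉ C := by
    have := hx
    simp only [foundViolators, violators, neighbours, Finset.mem_filter, Finset.mem_sdiff] at this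
    exact this.1.2
  have hxZ : x ∈ topViolators F C := by
    simp only [topViolators, Finset.mem_filter]
    refine ⟨hx, ⟨x, hx, rfl⟩, ?_⟩
    rintro v ⟨y, hy, rfl⟩
    exact hmax y hy
  refine Finset.card_lt_card (Finset.ssubset_iff_subset_ne.2 ⟨Finset.subset_union_left, ?_⟩)
  intro heq
  exact hxC (heq ▸ Finset.mem_union_right C hxZ)

/-- The outer loop, entered with the current set `C`: while violations are found, `C` is augmented
with the violating items of the largest rank. -/
def safeSearch (F : Finset (Finset A)) (C : Finset A) : Finset A :=
  if h : (foundViolators F C).Nonempty then safeSearch F (C ∪ topViolators F C) else C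
termination_by Fintype.card A - C.card
decreasing_by
  have h1 := card_lt_card_union_topViolators F C h
  have h2 := Finset.card_le_univ (C ∪ topViolators F C)
  omega

/-- The output of the algorithm on the input `B` and `F`. -/
def safe (B : Finset A) (F : Finset (Finset A)) : Finset A :=
  safeSearch F B

end Algorithm

end SafeProjection

/-! Call front of an item x outside C the set of items of C that x reaches through items outside C.
A set is safe iff all its nonempty fronts belong to F.

If they do, a distribution with the right frequencies on C has the same marginal on a front as a
given realisation of θ, so the two can be glued there, one component outside C at a time
(`exists_satisfies_of_front_mem`). If a front S is not in F, the uniform distributions on the even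
and on the odd subsets of S agree on all members of F inside C, but the component behind S can be
made to tell them apart (`front_mem_of_isSafe`).

When the search stops, its scans are the fronts, so the output is safe. Conversely, a safe Y
containing C contains every item added in a round (`topViolators_subset`): for an added x outside Y,
the front of x in Y would be a clique, and some item of it would be a violator of larger rank. By
induction the output lies in every safe set containing B, which gives minimality and uniqueness at
once. -/

namespace SafeProjection

/-! ### Images of finitely supported weights. -/

section Pushforward

variable {ι Ω : Type*} [DecidableEq Ω]

/-- The image under `g` of the weights `w` on the finite set `s`. -/
noncomputable def pushforward (s : Finset ι) (w : ι → ℝ) (g : ι → Ω) (z : Ω) : ℝ :=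
  ∑ t ∈ s, if g t = z then w t else 0

theorem sum_pushforward_mul [Fintype Ω] (s : Finset ι) (w : ι → ℝ) (g : ι → Ω) (f : Ω → ℝ) :
    ∑ z, pushforward s w g z * f z = ∑ t ∈ s, w t * f (g t) := by
  simp only [pushforward, Finset.sum_mul]
  rw [Finset.sum_comm]
  simp [ite_mul]

theorem pushforward_mem_stdSimplex [Fintype Ω] {s : Finset ι} {w : ι → ℝ} (g : ι → Ω)
    (hw : ∀ t ∈ s, 0 ≤ w t) (h1 : ∑ t ∈ s, w t = 1) :
    pushforward s w g ∈ stdSimplex ℝ Ω := by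
  refine ⟨fun z => Finset.sum_nonneg fun t ht => ?_, ?_⟩
  · split_ifs
    exacts [hw t ht, le_rfl]
  · simpa [h1] using sum_pushforward_mul s w g (fun _ => 1)

theorem exists_of_pushforward_ne_zero {s : Finset ι} {w : ι → ℝ} {g : ι → Ω} {z : Ω}
    (h : pushforward s w g z ≠ 0) : ∃ t ∈ s, g t = z ∧ w t ≠ 0 := by
  obtain ⟨t, ht, h⟩ := Finset.exists_ne_zero_of_sum_ne_zero h
  by_cases hg : g t = z
  · exact ⟨t, ht, hg, by simpa [hg] using h⟩
  · simp [hg] at h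

end Pushforward

/-! ### Frequencies and marginals. -/

section Expectation

variable {A : Type*}

theorem indicator_of_forall {U : Finset A} {z : A → Bool} (h : ∀ a ∈ U, z a = true) :
    indicator U z = 1 := if_pos h

theorem indicator_congr {U V : Finset A} {z z' : A → Bool}
    (h : (∀ a ∈ U, z a = true) ↔ ∀ a ∈ V, z' a = true) : indicator U z = indicator V z' := by
  unfold indicator
  exact if_congr h rfl rfl

theorem indicator_insert [DecidableEq A] (a : A) (U : Finset A) (z : A → Bool) :
    indicator (insert a U) z = if z a = true then indicator U z else 0 := by
  by_cases h : z a = true <;> simp [indicator, h]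

variable [Fintype A] [DecidableEq A]

theorem mean_pushforward {ι : Type*} (s : Finset ι) (w : ι → ℝ) (g : ι → A → Bool)
    (U : Finset A) : mean (pushforward s w g) U = ∑ t ∈ s, w t * indicator U (g t) :=
  sum_pushforward_mul s w g _

/-- Two distributions that give an itemset and a larger itemset the same frequency almost surely
do not distinguish them. -/
theorem forall_of_mean_eq {p : (A → Bool) → ℝ} (hp : ∀ z, 0 ≤ p z) {U V : Finset A} (hUV : U ⊆ V)
    (h : mean p U = mean p V) {z : A → Bool} (hz : p z ≠ 0) (hU : ∀ a ∈ U, z a = true) :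
    ∀ a ∈ V, z a = true := by
  by_contra hV
  have hlt : mean p V < mean p U := by
    refine Finset.sum_lt_sum (fun y _ => mul_le_mul_of_nonneg_left ?_ (hp y))
      ⟨z, Finset.mem_univ z, ?_⟩
    · by_cases hy : ∀ a ∈ V, y a = true
      · rw [indicator_of_forall hy, indicator_of_forall fun a ha => hy a (hUV ha)]
      · rw [indicator, if_neg hy, indicator]
        split_ifs <;> norm_num
    · rw [indicator_of_forall hU, indicator, if_neg hV]
      have := (hp z).lt_of_ne' hz
      simpa using this
  exact hlt.ne h.symm

/-- `p` and `p'` have the same marginals on `S`. -/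
def AgreeOn (S : Finset A) (p p' : (A → Bool) → ℝ) : Prop :=
  ∀ f : (A → Bool) → ℝ, (∀ z z' : A → Bool, (∀ a ∈ S, z a = z' a) → f z = f z') →
    ∑ z, p z * f z = ∑ z, p' z * f z

theorem AgreeOn.mean_eq {S U : Finset A} {p p' : (A → Bool) → ℝ} (h : AgreeOn S p p')
    (hU : U ⊆ S) : mean p U = mean p' U := by
  refine h _ fun z z' hz => indicator_congr ?_
  exact forall₂_congr fun a ha => by rw [hz a (hU ha)]

theorem AgreeOn.mono {S T : Finset A} {p p' : (A → Bool) → ℝ} (h : AgreeOn S p p')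
    (hT : T ⊆ S) : AgreeOn T p p' :=
  fun f hf => h f fun z z' hz => hf z z' fun a ha => hz a (hT ha)

theorem AgreeOn.trans {S : Finset A} {p p' p'' : (A → Bool) → ℝ} (h : AgreeOn S p p')
    (h' : AgreeOn S p' p'') : AgreeOn S p p'' :=
  fun f hf => (h f hf).trans (h' f hf)

/-- The frequencies of the subsets of `S` determine the marginal on `S`. -/
theorem agreeOn_of_mean_eq {S : Finset A} {p p' : (A → Bool) → ℝ}
    (h : ∀ V ⊆ S, mean p V = mean p' V) : AgreeOn S p p' := by
  -- Induction on the set R of items on which f depends; the itemset T collects the items already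
  -- eliminated.
  suffices H : ∀ R : Finset A, R ⊆ S → ∀ T ⊆ S, ∀ f : (A → Bool) → ℝ,
      (∀ z z' : A → Bool, (∀ a ∈ R, z a = z' a) → f z = f z') →
      ∑ z, p z * (f z * indicator T z) = ∑ z, p' z * (f z * indicator T z) by
    intro f hf
    simpa [indicator] using H S subset_rfl ∅ (Finset.empty_subset S) f hf
  intro R
  induction R using Finset.induction_on with
  | empty =>
    intro _ T hT f hf
    have hc : ∀ z, f z = f fun _ => false := fun z => hf _ _ (by simp)
    have := h T hT
    simp only [mean] at this
    calc ∑ z, p z * (f z * indicator T z)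
        = (f fun _ => false) * ∑ z, p z * indicator T z := by
          rw [Finset.mul_sum]
          exact Finset.sum_congr rfl fun z _ => by rw [hc z]; ring
      _ = (f fun _ => false) * ∑ z, p' z * indicator T z := by rw [this]
      _ = _ := by
          rw [Finset.mul_sum]
          exact Finset.sum_congr rfl fun z _ => by rw [hc z]; ring
  | insert a R _ ih =>
    intro hR T hT f hf
    have haS : a ∈ S := hR (Finset.mem_insert_self a R)
    have hRS : R ⊆ S := (Finset.subset_insert a R).trans hR
    have haT : insert a T ⊆ S := Finset.insert_subset haS hT
    have hdep : ∀ b : Bool, ∀ z z' : A → Bool, (∀ c ∈ R, z c = z' c) →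
        f (Function.update z a b) = f (Function.update z' a b) := by
      intro b z z' hz
      refine hf _ _ fun c hc => ?_
      by_cases hca : c = a
      · subst hca; simp
      · simpa [hca] using hz c (Finset.mem_of_mem_insert_of_ne hc hca)
    -- Split on the value of a: the condition that a is false is the difference of the indicators of
    -- T and of T with a.
    have key : ∀ z, f z * indicator T z = f (Function.update z a false) * indicator T z
        - f (Function.update z a false) * indicator (insert a T) z
        + f (Function.update z a true) * indicator (insert a T) z := by
      intro z
      rw [indicator_insert]
      cases hz : z a
      · have : Function.update z a false = z := by rw [← hz]; exact Function.update_eq_self a z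
        simp [this]
      · have : Function.update z a true = z := by rw [← hz]; exact Function.update_eq_self a z
        simp [this]
    simp only [key, mul_add, mul_sub, Finset.sum_add_distrib, Finset.sum_sub_distrib]
    rw [ih hRS T hT _ (hdep false), ih hRS _ haT _ (hdep false), ih hRS _ haT _ (hdep true)]

end Expectation

/-! ### Gluing two distributions along a common marginal. -/

section Gluing

variable {A : Type*} [Fintype A] [DecidableEq A]

/-- Since p and p' agree on S, the p'-mass of the class of a on S equals the denominator and cancels
it. This is the first marginal of the coupling used for gluing. -/
theorem sum_ite_agree_div (S : Finset A) {p p' : (A → Bool) → ℝ} (hp : ∀ z, 0 ≤ p z)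
    (h : AgreeOn S p p') (f : (A → Bool) → ℝ) :
    (∑ a, ∑ b, (if ∀ c ∈ S, a c = b c then p a * p' b /
      (∑ y, if ∀ c ∈ S, y c = a c then p y else 0) else 0) * f a) = ∑ a, p a * f a := by
  refine Finset.sum_congr rfl fun a _ => ?_
  rw [← Finset.sum_mul]
  congr 1
  set m := ∑ y, if ∀ c ∈ S, y c = a c then p y else 0 with hm
  have hm' : (∑ b, if ∀ c ∈ S, a c = b c then p' b else 0) = m := by
    have := h (fun y => if ∀ c ∈ S, y c = a c then 1 else 0) fun z z' hz =>
      if_congr (forall₂_congr fun c hc => by rw [hz c hc]) rfl rfl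
    simp only [mul_ite, mul_one, mul_zero] at this
    rw [hm, this]
    exact Finset.sum_congr rfl fun b _ =>
      if_congr (forall₂_congr fun c _ => eq_comm) rfl rfl
  have h1 : ∀ b, (if ∀ c ∈ S, a c = b c then p a * p' b / m else 0)
      = p a / m * (if ∀ c ∈ S, a c = b c then p' b else 0) := by
    intro b
    split_ifs <;> ring
  rw [Finset.sum_congr rfl fun b _ => h1 b, ← Finset.mul_sum, hm']
  have hle : p a ≤ m := by
    have := Finset.single_le_sum (f := fun y => if ∀ c ∈ S, y c = a c then p y else 0)
      (fun y _ => by split_ifs; exacts [hp y, le_rfl]) (Finset.mem_univ a)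
    simpa using this
  -- Division by zero is harmless: a class of mass zero forces p a = 0.
  by_cases h0 : m = 0
  · have : p a = 0 := le_antisymm (h0 ▸ hle) (hp a)
    simp [this]
  · field_simp

/-- Distributions that agree on `S` can be glued along `S`. -/
theorem exists_glue {C H S : Finset A} (hCH : Disjoint C H) {q p : (A → Bool) → ℝ}
    (hq : q ∈ stdSimplex ℝ (A → Bool)) (hp : p ∈ stdSimplex ℝ (A → Bool)) (h : AgreeOn S q p) :
    ∃ r ∈ stdSimplex ℝ (A → Bool), AgreeOn C r q ∧ AgreeOn (H ∪ S) r p := by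
  classical
  -- The two assignments are independent given their common values on S; g then reads H from the
  -- second one and everything else from the first.
  let w : (A → Bool) × (A → Bool) → ℝ := fun t => if ∀ c ∈ S, t.1 c = t.2 c then q t.1 * p t.2 /
      (∑ y, if ∀ c ∈ S, y c = t.1 c then q y else 0) else 0
  let g : (A → Bool) × (A → Bool) → A → Bool := fun t a => if a ∈ H then t.2 a else t.1 a
  have hw1 : ∀ f : (A → Bool) → ℝ, ∑ t, w t * f t.1 = ∑ a, q a * f a := by
    intro f
    rw [Fintype.sum_prod_type]
    exact sum_ite_agree_div S hq.1 h f
  have hw2 : ∀ f : (A → Bool) → ℝ, ∑ t, w t * f t.2 = ∑ a, p a * f a := by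
    intro f
    rw [Fintype.sum_prod_type_right, ← sum_ite_agree_div S hp.1 (fun f hf => (h f hf).symm) f]
    refine Finset.sum_congr rfl fun b _ => Finset.sum_congr rfl fun a _ => ?_
    congr 1
    -- On pairs that agree on S the denominator is also the p-mass of the class of the second
    -- assignment, so the coupling is symmetric.
    refine ite_congr (propext (forall₂_congr fun c _ => eq_comm)) (fun hab => ?_) fun _ => rfl
    have := h (fun y => if ∀ c ∈ S, y c = b c then 1 else 0) fun z z' hz =>
      if_congr (forall₂_congr fun c hc => by rw [hz c hc]) rfl rfl
    simp only [mul_ite, mul_one, mul_zero] at this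
    rw [← this, mul_comm (q a)]
    congr 1
    exact Finset.sum_congr rfl fun y _ =>
      if_congr (forall₂_congr fun c hc => by rw [hab c hc]) rfl rfl
  refine ⟨pushforward Finset.univ w g, pushforward_mem_stdSimplex g (fun t _ => ?_) ?_, ?_, ?_⟩
  · dsimp only [w]
    split_ifs
    · refine div_nonneg (mul_nonneg (hq.1 _) (hp.1 _)) (Finset.sum_nonneg fun y _ => ?_)
      split_ifs
      exacts [hq.1 y, le_rfl]
    · exact le_rfl
  · simpa [hq.2] using hw1 fun _ => 1
  · intro f hf
    rw [sum_pushforward_mul, ← hw1]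
    refine Finset.sum_congr rfl fun t _ => congrArg _ (hf _ _ fun a ha => ?_)
    simp [g, Finset.disjoint_left.1 hCH ha]
  · intro f hf
    rw [sum_pushforward_mul, ← hw2]
    refine Finset.sum_congr rfl fun t _ => ?_
    by_cases ht : ∀ c ∈ S, t.1 c = t.2 c
    · refine congrArg _ (hf _ _ fun a ha => ?_)
      by_cases haH : a ∈ H
      · simp [g, haH]
      · have haS : a ∈ S := (Finset.mem_union.1 ha).resolve_left haH
        simp [g, haH, ht a haS]
    · simp [w, ht]

end Gluing


/-! ### Passing between itemsets over C and over A. -/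

section Lift

variable {A : Type*} {C : Finset A}

/-- The extension of an assignment by `false`. -/
def extend [DecidableEq A] (C : Finset A) (w : C → Bool) (a : A) : Bool :=
  if h : a ∈ C then w ⟨a, h⟩ else false

@[simp]
theorem extend_apply [DecidableEq A] (w : C → Bool) (a : C) : extend C w a = w a := by
  simp [extend]

theorem mem_liftItemset {U : Finset C} {a : A} :
    a ∈ liftItemset C U ↔ ∃ h : a ∈ C, (⟨a, h⟩ : C) ∈ U := by
  simp [liftItemset]

theorem indicator_liftItemset (U : Finset C) (z : A → Bool) :
    indicator (liftItemset C U) z = indicator U fun a : C => z a := by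
  unfold indicator
  refine if_congr ⟨?_, ?_⟩ rfl rfl
  · exact fun h a ha => h a (mem_liftItemset.2 ⟨a.2, ha⟩)
  · intro h a ha
    obtain ⟨haC, haU⟩ := mem_liftItemset.1 ha
    exact h _ haU

theorem liftItemset_subset (U : Finset C) : liftItemset C U ⊆ C :=
  fun _ ha => (mem_liftItemset.1 ha).1

theorem exists_liftItemset_eq [DecidableEq A] {U : Finset A} (hU : U ⊆ C) : ∃ U' : Finset C, liftItemset C U' = U :=
  ⟨Finset.univ.filter fun a : C => (a : A) ∈ U, by
    ext a
    simp only [mem_liftItemset, Finset.mem_filter, Finset.mem_univ, true_and, exists_prop]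
    exact ⟨fun h => h.2, fun h => ⟨hU h, h⟩⟩⟩

end Lift

/-! ### Fronts and components; fronts in F imply safety. -/

section Front

variable {A : Type*} [DecidableEq A] {F : Finset (Finset A)} {C : Finset A}

/-- A step along an edge of the dependency graph that starts outside `C`. -/
def Step (F : Finset (Finset A)) (C : Finset A) (a b : A) : Prop :=
  a ∉ C ∧ (dependencyGraph F).Adj a b

theorem Step.symm {a b : A} (h : Step F C a b) (hb : b ∉ C) : Step F C b a :=
  ⟨hb, h.2.symm⟩

theorem Step.pair_mem {a b : A} (h : Step F C a b) : ({a, b} : Finset A) ∈ F := h.2.2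

/-- `y` can be reached from `x` by a walk of which only the last item may belong to `C`. -/
def Reaches (F : Finset (Finset A)) (C : Finset A) : A → A → Prop :=
  Relation.ReflTransGen (Step F C)

theorem adj_of_mem (hF : Antimonotonic F) {U : Finset A} (hU : U ∈ F) {a b : A}
    (ha : a ∈ U) (hb : b ∈ U) (hab : a ≠ b) : (dependencyGraph F).Adj a b :=
  ⟨hab, hF U hU _ (by simp [Finset.insert_subset_iff, ha, hb])⟩

variable [Fintype A]

open Classical in
/-- The items of `C` that can be reached from `x` by a walk outside `C`. -/
noncomputable def front (F : Finset (Finset A)) (C : Finset A) (x : A) : Finset A :=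
  Finset.univ.filter fun y => y ∈ C ∧ Reaches F C x y

open Classical in
/-- The connected component of `x` outside `C`. -/
noncomputable def component (F : Finset (Finset A)) (C : Finset A) (x : A) : Finset A :=
  Finset.univ.filter fun y => y ∉ C ∧ Reaches F C x y

theorem mem_front {x y : A} : y ∈ front F C x ↔ y ∈ C ∧ Reaches F C x y := by
  simp [front]

theorem mem_component {x y : A} : y ∈ component F C x ↔ y ∉ C ∧ Reaches F C x y := by
  simp [component]

theorem front_subset {x : A} : front F C x ⊆ C := fun _ h => (mem_front.1 h).1

theorem mem_component_self {x : A} (hx : x ∉ C) : x ∈ component F C x :=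
  mem_component.2 ⟨hx, .refl⟩

theorem disjoint_component {x : A} : Disjoint C (component F C x) :=
  Finset.disjoint_left.2 fun _ ha h => (mem_component.1 h).1 ha

theorem step_of_mem_component {x a b : A} (ha : a ∈ component F C x)
    (hab : (dependencyGraph F).Adj a b) : b ∈ component F C x ∪ front F C x := by
  obtain ⟨haC, hxa⟩ := mem_component.1 ha
  have hxb : Reaches F C x b := hxa.tail ⟨haC, hab⟩
  by_cases hb : b ∈ C
  · exact Finset.mem_union_right _ (mem_front.2 ⟨hb, hxb⟩)
  · exact Finset.mem_union_left _ (mem_component.2 ⟨hb, hxb⟩)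

/-- A member of `F` that meets a component lies in its closure. -/
theorem subset_closure_component (hF : Antimonotonic F) {x a : A} {U : Finset A} (hU : U ∈ F)
    (haU : a ∈ U) (ha : a ∈ component F C x) : U ⊆ component F C x ∪ front F C x := by
  intro b hb
  by_cases hab : a = b
  · exact hab ▸ Finset.mem_union_left _ ha
  · exact step_of_mem_component ha (adj_of_mem hF hU haU hb hab)

/-- A walk from y cannot enter the component of x: an item outside C adjacent to the component
already belongs to it. -/
theorem front_union_component_subset {x y : A} (hy : y ∉ C ∪ component F C x) :
    front F (C ∪ component F C x) y ⊆ front F C y := by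
  have key : ∀ c, Reaches F (C ∪ component F C x) y c →
      Reaches F C y c ∧ c ∉ component F C x := by
    intro c hc
    induction hc with
    | refl => exact ⟨.refl, fun h => hy (Finset.mem_union_right _ h)⟩
    | @tail b c _ hbc ih =>
      have hb : b ∉ C ∧ b ∉ component F C x := by simpa using hbc.1
      refine ⟨ih.1.tail ⟨hb.1, hbc.2⟩, fun hc => ?_⟩
      have := step_of_mem_component hc hbc.2.symm
      rcases Finset.mem_union.1 this with h | h
      · exact hb.2 h
      · exact hb.1 (front_subset h)
  intro c hc
  obtain ⟨hcC, hyc⟩ := mem_front.1 hc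
  obtain ⟨h1, h2⟩ := key c hyc
  exact mem_front.2 ⟨(Finset.mem_union.1 hcC).resolve_right h2, h1⟩

/-- If the fronts of `C` are members of `F`, then a distribution with the right frequencies on `C`
agrees on `C` with one that has the right frequencies everywhere. -/
theorem exists_satisfies_of_front_mem (hF : Antimonotonic F) {p : (A → Bool) → ℝ}
    (hp : p ∈ stdSimplex ℝ (A → Bool)) (C : Finset A)
    (hC : ∀ x ∉ C, front F C x = ∅ ∨ front F C x ∈ F) {q : (A → Bool) → ℝ}
    (hq : q ∈ stdSimplex ℝ (A → Bool)) (hqp : ∀ U ∈ F, U ⊆ C → mean q U = mean p U) :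
    ∃ r ∈ stdSimplex ℝ (A → Bool), AgreeOn C r q ∧ ∀ U ∈ F, mean r U = mean p U := by
  by_cases hex : ∃ x, x ∉ C
  · obtain ⟨x, hx⟩ := hex
    have hagree : AgreeOn (front F C x) q p := by
      refine agreeOn_of_mean_eq fun V hV => ?_
      -- The empty front is treated apart because an empty family does not contain it; there only
      -- the total mass matters.
      rcases hC x hx with h | h
      · obtain rfl : V = ∅ := Finset.subset_empty.1 (h ▸ hV)
        simp [mean, indicator, hq.2, hp.2]
      · exact hqp V (hF _ h V hV) (hV.trans front_subset)
    obtain ⟨r, hr, hrq, hrp⟩ := exists_glue (disjoint_component (F := F) (x := x)) hq hp hagree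
    have hsub : ∀ y ∉ C ∪ component F C x, front F (C ∪ component F C x) y = ∅ ∨
        front F (C ∪ component F C x) y ∈ F := by
      intro y hy
      have hs := front_union_component_subset hy
      rcases hC y (fun h => hy (Finset.mem_union_left _ h)) with h | h
      · exact Or.inl (Finset.subset_empty.1 (h ▸ hs))
      · exact Or.inr (hF _ h _ hs)
    have hmean : ∀ U ∈ F, U ⊆ C ∪ component F C x → mean r U = mean p U := by
      intro U hU hUC
      -- A member of F not inside C meets the component, hence lies in its closure, where r agrees
      -- with p.
      by_cases hUC' : U ⊆ C
      · rw [hrq.mean_eq hUC', hqp U hU hUC']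
      · obtain ⟨a, haU, haC⟩ := Finset.not_subset.1 hUC'
        exact hrp.mean_eq (subset_closure_component hF hU haU
          ((Finset.mem_union.1 (hUC haU)).resolve_left haC))
    have hlt : C.card < (C ∪ component F C x).card :=
      Finset.card_lt_card ⟨Finset.subset_union_left, fun h =>
        hx (h (Finset.mem_union_right _ (mem_component_self hx)))⟩
    have hle := Finset.card_le_univ (C ∪ component F C x)
    obtain ⟨r', hr', hr'r, hr'p⟩ :=
      exists_satisfies_of_front_mem hF hp (C ∪ component F C x) hsub hr hmean
    exact ⟨r', hr', (hr'r.mono Finset.subset_union_left).trans hrq, hr'p⟩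
  · push Not at hex
    exact ⟨q, hq, fun _ _ => rfl, fun U hU => hqp U hU fun a _ => hex a⟩
termination_by Fintype.card A - C.card

/-- A set with all its fronts in `F` is safe. -/
theorem isSafe_of_front_mem (hF : Antimonotonic F)
    (hC : ∀ x ∉ C, front F C x = ∅ ∨ front F C x ∈ F) : IsSafe F C := by
  rintro θ ⟨p, hp, hpθ⟩ q hq hqθ
  have hq' := pushforward_mem_stdSimplex (s := Finset.univ) (extend C) (fun t _ => hq.1 t) hq.2
  obtain ⟨r, hr, hrq, hrp⟩ := exists_satisfies_of_front_mem hF hp C hC hq' (by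
    intro U hU hUC
    obtain ⟨U, rfl⟩ := exists_liftItemset_eq hUC
    rw [mean_pushforward, hpθ _ hU]
    simp only [indicator_liftItemset, extend_apply]
    exact hqθ U (by simpa [projFamily] using hU))
  refine ⟨r, hr, ?_, fun U hU => (hrp U hU).trans (hpθ U hU)⟩
  funext w
  have h := hrq (fun z => if ∀ a : C, z a = w a then 1 else 0) fun z z' hz =>
    if_congr (forall_congr' fun a => by rw [hz a a.2]) rfl rfl
  rw [sum_pushforward_mul] at h
  simpa [marginal, Finset.sum_filter, ← funext_iff] using h

end Front

/-! ### Safety forces the fronts into F: the parity construction. -/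

section Necessity

variable {A : Type*}

/-- The weights of the uniform distribution on the subsets of `S` of even (`ε = 1`) or odd
(`ε = -1`) cardinality. -/
noncomputable def parityWeight (S : Finset A) (ε : ℝ) (T : Finset A) : ℝ :=
  (1 + ε * (-1) ^ T.card) / 2 ^ S.card

theorem parityWeight_nonneg (S : Finset A) {ε : ℝ} (hε : ε = 1 ∨ ε = -1) (T : Finset A) :
    0 ≤ parityWeight S ε T := by
  refine div_nonneg ?_ (by positivity)
  rcases neg_one_pow_eq_or ℝ T.card with h | h <;> rcases hε with rfl | rfl <;> rw [h] <;> norm_num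

/-- The assignment that is true on `T`, and on `H` if `T` is nonempty. -/
def spread [DecidableEq A] (H T : Finset A) (a : A) : Bool :=
  decide (a ∈ T ∨ a ∈ H ∧ T.Nonempty)

theorem spread_eq_true [DecidableEq A] {H T : Finset A} {a : A} :
    spread H T a = true ↔ a ∈ T ∨ a ∈ H ∧ T.Nonempty := by
  simp [spread]

variable [DecidableEq A]

/-- The terms of T and of T with s added cancel. -/
theorem sum_powerset_neg_one_pow_mul {S : Finset A} {s : A} (hs : s ∈ S) (f : Finset A → ℝ)
    (hf : ∀ T, s ∉ T → f (insert s T) = f T) :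
    ∑ T ∈ S.powerset, (-1 : ℝ) ^ T.card * f T = 0 := by
  rw [← Finset.insert_erase hs, Finset.sum_powerset_insert (Finset.notMem_erase s S),
    ← Finset.sum_add_distrib]
  refine Finset.sum_eq_zero fun T hT => ?_
  have hsT : s ∉ T := fun h => Finset.notMem_erase s S (Finset.mem_powerset.1 hT h)
  rw [Finset.card_insert_of_notMem hsT, hf T hsT]
  ring

/-- The right-hand side is free of ε: a function blind to one item of S cannot see the parity. -/
theorem sum_parityWeight_mul {S : Finset A} {s : A} (hs : s ∈ S) (ε : ℝ) (f : Finset A → ℝ)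
    (hf : ∀ T, s ∉ T → f (insert s T) = f T) :
    ∑ T ∈ S.powerset, parityWeight S ε T * f T = (∑ T ∈ S.powerset, f T) / 2 ^ S.card := by
  have h : ∀ T, parityWeight S ε T * f T
      = f T / 2 ^ S.card + ε / 2 ^ S.card * ((-1) ^ T.card * f T) := by
    intro T; unfold parityWeight; ring
  simp only [h]
  rw [Finset.sum_add_distrib, ← Finset.mul_sum, sum_powerset_neg_one_pow_mul hs f hf,
    Finset.sum_div]
  ring

theorem sum_parityWeight {S : Finset A} (hS : S.Nonempty) (ε : ℝ) :
    ∑ T ∈ S.powerset, parityWeight S ε T = 1 := by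
  obtain ⟨s, hs⟩ := hS
  have := sum_parityWeight_mul hs ε (fun _ => 1) fun _ _ => rfl
  simp only [mul_one, Finset.sum_const, Finset.card_powerset, nsmul_eq_mul] at this
  rw [this]
  push_cast
  exact div_self (by positivity)

variable [Fintype A] {F : Finset (Finset A)} {C : Finset A}

/-- The fronts of a safe set are members of `F`. -/
theorem front_mem_of_isSafe (hF : Antimonotonic F) (hC : IsSafe F C) {x : A} (hx : x ∉ C)
    (hne : (front F C x).Nonempty) : front F C x ∈ F := by
  by_contra hfr
  set S := front F C x
  have hSC : S ⊆ C := front_subset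
  have hxF : {x} ∈ F := by
    obtain ⟨s, hs⟩ := hne
    obtain ⟨hsC, hxs⟩ := mem_front.1 hs
    rcases Relation.ReflTransGen.cases_head hxs with rfl | ⟨b, hb, -⟩
    · exact absurd hsC hx
    · exact hF _ hb.pair_mem _ (by simp)
  set H := component F C x
  have hHS : ∀ a ∈ H, a ∉ C := fun a ha => (mem_component.1 ha).1
  -- Both distributions draw a subset T of S, even for p and odd for q. In p the whole component H
  -- is true exactly when T is nonempty; q records only the items of C.
  set p := pushforward S.powerset (parityWeight S 1) (spread H) with hp_def
  have hp : p ∈ stdSimplex ℝ (A → Bool) := pushforward_mem_stdSimplex _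
    (fun T _ => parityWeight_nonneg S (.inl rfl) T) (sum_parityWeight hne 1)
  set q : (C → Bool) → ℝ := pushforward S.powerset (parityWeight S (-1))
    (fun T (a : C) => spread H T a) with hq_def
  have hq : q ∈ stdSimplex ℝ (C → Bool) := pushforward_mem_stdSimplex _
    (fun T _ => parityWeight_nonneg S (.inr rfl) T) (sum_parityWeight hne (-1))
  have hqp : Satisfies (projFamily C F) (projFreq C (mean p)) q := by
    intro U hU
    have hUF : liftItemset C U ∈ F := by simpa [projFamily] using hU
    have hUC := liftItemset_subset U
    rw [projFreq, hp_def, hq_def, mean_pushforward, mean_pushforward]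
    simp only [← indicator_liftItemset U (spread H _)]
    have hT : ∀ T, indicator (liftItemset C U) (spread H T)
        = if liftItemset C U ⊆ T then 1 else 0 := by
      intro T
      have : (∀ a ∈ liftItemset C U, spread H T a = true) ↔ liftItemset C U ⊆ T := by
        refine forall₂_congr fun a ha => ?_
        rw [spread_eq_true]
        exact or_iff_left fun h => hHS a h.1 (hUC ha)
      simp only [indicator, this]
    simp only [hT]
    by_cases hUS : liftItemset C U ⊆ S
    -- S is not in F, so a member of F inside S misses an item of S and is blind to the parity.
    · obtain ⟨s, hsS, hsU⟩ : ∃ s ∈ S, s ∉ liftItemset C U := Finset.not_subset.1 fun h =>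
        hfr (Finset.Subset.antisymm hUS h ▸ hUF)
      have hf : ∀ T, s ∉ T → (if liftItemset C U ⊆ insert s T then (1 : ℝ) else 0)
          = if liftItemset C U ⊆ T then 1 else 0 := fun T _ =>
        if_congr (Finset.subset_insert_iff_of_notMem hsU) rfl rfl
      rw [sum_parityWeight_mul hsS _ _ hf, sum_parityWeight_mul hsS _ _ hf]
    · refine Finset.sum_congr rfl fun T hT => ?_
      rw [if_neg fun h => hUS (h.trans (Finset.mem_powerset.1 hT))]
      simp
  obtain ⟨r, hr, hrq, hrp⟩ := hC (mean p) ⟨p, hp, fun _ _ => rfl⟩ q hq hqp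
  -- Under p, a true item of H ∪ S makes all of H true. The frequencies of edges record this, so r
  -- inherits it.
  have hspread : ∀ b ∈ H, ∀ c ∈ H ∪ S, (dependencyGraph F).Adj b c →
      ∀ z, r z ≠ 0 → z c = true → z b = true := by
    intro b hb c hc hbc z hz hzc
    have hbcF : ({b, c} : Finset A) ∈ F := hbc.2
    refine forall_of_mean_eq hr.1 (U := {c}) (V := {b, c}) (by simp) ?_ hz (by simpa using hzc) b
      (by simp)
    rw [hrp _ hbcF, hrp _ (hF _ hbcF _ (by simp)), hp_def, mean_pushforward, mean_pushforward]
    refine Finset.sum_congr rfl fun T _ => congrArg _ (indicator_congr ?_)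
    simp only [Finset.mem_singleton, forall_eq, Finset.mem_insert, forall_eq_or_imp,
      spread_eq_true, iff_and_self]
    rintro (h | h)
    · exact Or.inr ⟨hb, c, h⟩
    · exact Or.inr ⟨hb, h.2⟩
  have hback : ∀ z, r z ≠ 0 → ∀ y, Reaches F C x y → (y ∈ C → y ∈ S) → z y = true →
      z x = true := by
    intro z hz y hy
    induction hy with
    | refl => exact fun _ h => h
    | @tail b c hxb hbc ih =>
      intro hcS hzc
      have hbH : b ∈ H := mem_component.2 ⟨hbc.1, hxb⟩
      have hc : c ∈ H ∪ S := by
        by_cases hcC : c ∈ C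
        · exact Finset.mem_union_right _ (hcS hcC)
        · exact Finset.mem_union_left _ (mem_component.2 ⟨hcC, hxb.tail hbc⟩)
      exact ih (fun h => absurd h hbc.1) (hspread b hbH c hc hbc.2 z hz hzc)
  -- An odd subset is nonempty, so some item of S is true, and truth travels back along a walk to x.
  have hzx : ∀ z, r z ≠ 0 → z x = true := by
    intro z hz
    have hqz : q (fun a => z a) ≠ 0 := by
      rw [← hrq]
      refine (lt_of_lt_of_le ((hr.1 z).lt_of_ne' hz) ?_).ne'
      exact Finset.single_le_sum (f := r) (fun y _ => hr.1 y) (by simp)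
    obtain ⟨T, hTS, hTz, hT⟩ := exists_of_pushforward_ne_zero hqz
    have hTne : T.Nonempty := by
      rw [Finset.nonempty_iff_ne_empty]
      rintro rfl
      simp [parityWeight] at hT
    obtain ⟨s, hs⟩ := hTne
    have hsS := Finset.mem_powerset.1 hTS hs
    refine hback z hz s (mem_front.1 hsS).2 (fun _ => hsS) ?_
    have := congrFun hTz ⟨s, hSC hsS⟩
    simp only at this
    rw [← this, spread_eq_true]
    exact Or.inl hs
  have h1 : mean r {x} = 1 := by
    rw [← hr.2]
    refine Finset.sum_congr rfl fun z _ => ?_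
    by_cases hz : r z = 0
    · simp [hz]
    · rw [indicator_of_forall (by simpa using hzx z hz), mul_one]
  -- The empty set is even, so x is false with positive probability under p.
  have h2 : mean p {x} < 1 := by
    rw [hp_def, mean_pushforward]
    refine lt_of_lt_of_eq ?_ (sum_parityWeight hne 1)
    refine Finset.sum_lt_sum (fun T _ => mul_le_of_le_one_right
      (parityWeight_nonneg S (.inl rfl) T) ?_) ⟨∅, Finset.empty_mem_powerset S, ?_⟩
    · unfold indicator
      split_ifs <;> norm_num
    · simp only [indicator, Finset.mem_singleton, forall_eq, spread_eq_true]
      simp only [parityWeight]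
      simp
  exact h2.ne ((hrp _ hxF).symm.trans h1)

end Necessity


/-! ### Correctness of the search. -/

section Algorithm

variable {A : Type*} [Fintype A] [DecidableEq A] {F : Finset (Finset A)} {C : Finset A}

theorem mem_restrictedNbhd {r : ℕ} {x y : A} : y ∈ restrictedNbhd F C x r ↔
    ∃ P : (dependencyGraph F).Walk x y,
      P.IsPath ∧ P.length ≤ r ∧ ∀ z ∈ P.support, z ∈ C → z = y := by
  simp [restrictedNbhd]

theorem mem_restrictedNbhd_zero {x y : A} : y ∈ restrictedNbhd F C x 0 ↔ y = x := by
  rw [mem_restrictedNbhd]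
  constructor
  · rintro ⟨P, -, hP, -⟩
    exact (P.eq_of_length_eq_zero (Nat.le_zero.1 hP)).symm
  · rintro rfl
    exact ⟨.nil, by simp⟩

/-- Walks may replace paths: bypassing repetitions neither lengthens a walk nor adds items to it. -/
theorem mem_restrictedNbhd_succ {r : ℕ} {x y : A} : y ∈ restrictedNbhd F C x (r + 1) ↔
    y = x ∨ ∃ z, Step F C x z ∧ y ∈ restrictedNbhd F C z r := by
  simp only [mem_restrictedNbhd]
  constructor
  · rintro ⟨P, hP, hlen, hC⟩
    cases P with
    | nil => exact Or.inl rfl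
    | @cons _ z _ h Q =>
      refine or_iff_not_imp_left.2 fun hne => ⟨z, ⟨fun hx => hne ?_, h⟩, Q, hP.of_cons, ?_, ?_⟩
      · exact (hC x (by simp) hx).symm
      · simpa using hlen
      · exact fun a ha => hC a (by simp [ha])
  · classical
    rintro (rfl | ⟨z, hxz, P, -, hlen, hC⟩)
    · exact ⟨.nil, by simp⟩
    · refine ⟨(P.cons hxz.2).bypass, SimpleGraph.Walk.bypass_isPath _,
        (SimpleGraph.Walk.length_bypass_le_length _).trans (by simpa using hlen), fun a ha haC => ?_⟩
      have := SimpleGraph.Walk.support_bypass_subset_support _ ha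
      rw [SimpleGraph.Walk.support_cons, List.mem_cons] at this
      rcases this with rfl | h
      · exact absurd haC hxz.1
      · exact hC a h haC

theorem restrictedNbhd_mono {x : A} : Monotone (restrictedNbhd F C x) := by
  intro r r' hr y hy
  obtain ⟨P, hP, hlen, hC⟩ := mem_restrictedNbhd.1 hy
  exact mem_restrictedNbhd.2 ⟨P, hP, hlen.trans hr, hC⟩

theorem mem_restrictedNbhd_card {r : ℕ} {x y : A} (h : y ∈ restrictedNbhd F C x r) :
    y ∈ restrictedNbhd F C x (Fintype.card A - 1) := by
  obtain ⟨P, hP, -, hC⟩ := mem_restrictedNbhd.1 h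
  exact mem_restrictedNbhd.2 ⟨P, hP, Nat.le_sub_one_of_lt hP.length_lt, hC⟩

theorem reaches_of_mem_restrictedNbhd {r : ℕ} {x y : A} (h : y ∈ restrictedNbhd F C x r) :
    Reaches F C x y := by
  induction r generalizing x with
  | zero => rw [mem_restrictedNbhd_zero.1 h]; exact .refl
  | succ r ih =>
    rcases mem_restrictedNbhd_succ.1 h with rfl | ⟨z, hxz, hz⟩
    · exact .refl
    · exact .head hxz (ih hz)

theorem exists_mem_restrictedNbhd {x y : A} (h : Reaches F C x y) :
    ∃ r, y ∈ restrictedNbhd F C x r := by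
  induction h using Relation.ReflTransGen.head_induction_on with
  | refl => exact ⟨0, mem_restrictedNbhd_zero.2 rfl⟩
  | head h _ ih =>
    obtain ⟨r, hr⟩ := ih
    exact ⟨r + 1, mem_restrictedNbhd_succ.2 (Or.inr ⟨_, h, hr⟩)⟩

theorem scan_mono {x : A} {r r' : ℕ} (h : r ≤ r') : scan F C r x ⊆ scan F C r' x :=
  Finset.inter_subset_inter_right (restrictedNbhd_mono h)

theorem scan_subset_front {x : A} {r : ℕ} : scan F C r x ⊆ front F C x := fun y hy => by
  rw [scan, Finset.mem_inter] at hy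
  exact mem_front.2 ⟨hy.2, reaches_of_mem_restrictedNbhd hy.1⟩

theorem mem_neighbours {x : A} :
    x ∈ neighbours F C ↔ x ∉ C ∧ ∃ y ∈ C, (dependencyGraph F).Adj x y := by
  simp [neighbours, and_comm]

theorem front_eq_scan {x : A} {r : ℕ} (hx : x ∈ neighbours F C) (h : Stable F C r) :
    front F C x = scan F C r x := by
  refine Finset.Subset.antisymm (fun y hy => ?_) scan_subset_front
  obtain ⟨hyC, hxy⟩ := mem_front.1 hy
  obtain ⟨r', hr'⟩ := exists_mem_restrictedNbhd hxy
  rw [← h x hx (max r r') (le_max_left _ _)]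
  exact scan_mono (le_max_right _ _) (Finset.mem_inter.2 ⟨hr', hyC⟩)

/-- Steps between items outside C are reversible. -/
theorem front_eq_front {x y : A} (hxy : Reaches F C x y) (hy : y ∉ C) :
    front F C x = front F C y := by
  have key : Reaches F C y x := by
    have : ∀ z, Reaches F C x z → z ∉ C → Reaches F C z x := by
      intro z hz
      induction hz with
      | refl => exact fun _ => .refl
      | tail _ hbc ih => exact fun hc => .head (hbc.symm hc) (ih hbc.1)
    exact this y hxy hy
  ext z
  simp only [mem_front]
  exact and_congr_right fun _ => ⟨key.trans, hxy.trans⟩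

/-- This is why scanning only the neighbours of C suffices: the last item before C on a walk has the
same front as the start. -/
theorem front_eq_empty_or_exists_neighbour {x : A} (hx : x ∉ C) :
    front F C x = ∅ ∨ ∃ y ∈ neighbours F C, front F C x = front F C y := by
  rcases Finset.eq_empty_or_nonempty (front F C x) with h | ⟨c, hc⟩
  · exact Or.inl h
  · obtain ⟨hcC, hxc⟩ := mem_front.1 hc
    rcases Relation.ReflTransGen.cases_tail hxc with rfl | ⟨b, hxb, hbc⟩
    · exact absurd hcC hx
    · exact Or.inr ⟨b, mem_neighbours.2 ⟨hbc.1, c, hcC, hbc.2⟩, front_eq_front hxb hbc.1⟩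

theorem innerLoop_spec (F : Finset (Finset A)) (C : Finset A) (r : ℕ) :
    (violators F C (innerLoop F C r)).Nonempty ∨ Stable F C (innerLoop F C r) := by
  induction r using innerLoop.induct F C with
  | case1 r h => rwa [innerLoop, dif_pos h]
  | case2 r h ih => rwa [innerLoop, dif_neg h]

/-- The algorithm stops at a safe set. -/
theorem isSafe_of_foundViolators_eq_empty (hF : Antimonotonic F)
    (h : ¬ (foundViolators F C).Nonempty) : IsSafe F C := by
  have hst : Stable F C (innerLoop F C 1) := (innerLoop_spec F C 1).resolve_left h
  refine isSafe_of_front_mem hF fun x hx => ?_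
  refine (front_eq_empty_or_exists_neighbour hx).imp_right ?_
  rintro ⟨y, hy, hxy⟩
  rw [hxy, front_eq_scan hy hst]
  by_contra hyF
  exact h ⟨y, Finset.mem_filter.2 ⟨hy, hyF⟩⟩

theorem scan_zero {x : A} (hx : x ∉ C) : scan F C 0 x = ∅ := by
  ext y
  simp only [scan, Finset.mem_inter, mem_restrictedNbhd_zero, Finset.notMem_empty, iff_false]
  rintro ⟨rfl, h⟩
  exact hx h

theorem rank_apply (F : Finset (Finset A)) (C : Finset A) (x : A)
    (i : Fin (Fintype.card A - 1)) :
    rank F C x i = (scan F C (i + 1) x).card - (scan F C i x).card := by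
  have h : C ∩ (restrictedNbhd F C x (i + 1) \ restrictedNbhd F C x i)
      = scan F C (i + 1) x \ scan F C i x := by
    ext y
    simp only [scan, Finset.mem_inter, Finset.mem_sdiff]
    tauto
  change (C ∩ (restrictedNbhd F C x (i + 1) \ restrictedNbhd F C x i)).card = _
  rw [h, Finset.card_sdiff_of_subset (scan_mono (Nat.le_succ _))]

/-- An item that scans at least as much as `x` at every radius, and more at some radius, has a
larger rank. -/
theorem rank_lt_rank {x z : A} (hx : x ∉ C) (hz : z ∉ C)
    (hle : ∀ r, scan F C r x ⊆ scan F C r z) {r : ℕ} (hne : scan F C r x ≠ scan F C r z) :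
    rank F C x < rank F C z := by
  classical
  have hex : ∃ r, scan F C r x ≠ scan F C r z := ⟨r, hne⟩
  obtain ⟨i, hi⟩ : ∃ i, Nat.find hex = i + 1 := by
    refine Nat.exists_eq_succ_of_ne_zero fun h0 => ?_
    have := Nat.find_spec hex
    rw [h0, scan_zero hx, scan_zero hz] at this
    exact this rfl
  have hspec : scan F C (i + 1) x ≠ scan F C (i + 1) z := hi ▸ Nat.find_spec hex
  have hmin : ∀ j ≤ i, scan F C j x = scan F C j z := fun j hj => by
    by_contra h
    have := Nat.find_min' hex h
    omega
  -- A path has at most |A| - 1 edges, so no scan grows beyond that radius and the first difference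
  -- falls within the entries of the rank.
  have hcard : i < Fintype.card A - 1 := by
    by_contra hi'
    have hsub : scan F C (i + 1) z ⊆ scan F C i z := fun y hy => by
      obtain ⟨hy1, hy2⟩ := Finset.mem_inter.1 hy
      exact Finset.mem_inter.2
        ⟨restrictedNbhd_mono (not_lt.1 hi') (mem_restrictedNbhd_card hy1), hy2⟩
    refine hspec (Finset.Subset.antisymm (hle _) (hsub.trans ?_))
    rw [← hmin i le_rfl]
    exact scan_mono (Nat.le_succ i)
  refine ⟨⟨i, hcard⟩, fun j hj => ?_, ?_⟩
  · have hj' : (j : ℕ) < i := hj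
    change rank F C x j = rank F C z j
    rw [rank_apply, rank_apply, hmin j hj'.le, hmin (j + 1) hj']
  · change rank F C x ⟨i, hcard⟩ < rank F C z ⟨i, hcard⟩
    rw [rank_apply, rank_apply]
    have h1 := Finset.card_lt_card ((hle (i + 1)).ssubset_of_ne hspec)
    have h2 := congrArg Finset.card (hmin i le_rfl)
    have h3 := Finset.card_le_card (scan_mono (F := F) (C := C) (x := x) (Nat.le_succ i))
    dsimp only at *
    simp only [Nat.succ_eq_add_one] at h3
    omega

/-- A restricted walk from `x ∉ Y` to an item of `C ⊆ Y` has a first item in `Y`. -/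
theorem exists_mem_front_mem_restrictedNbhd {Y : Finset A} (hCY : C ⊆ Y) {x u : A} {r : ℕ}
    (hx : x ∉ Y) (hu : u ∈ scan F C r x) :
    ∃ y ∈ front F Y x, ∃ k < r, u ∈ scan F C k y := by
  obtain ⟨hur, huC⟩ := Finset.mem_inter.1 hu
  induction r generalizing x with
  | zero =>
    obtain rfl := mem_restrictedNbhd_zero.1 hur
    exact absurd (hCY huC) hx
  | succ r ih =>
    rcases mem_restrictedNbhd_succ.1 hur with rfl | ⟨z, hxz, hz⟩
    · exact absurd (hCY huC) hx
    · have hstep : Step F Y x z := ⟨hx, hxz.2⟩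
      by_cases hzY : z ∈ Y
      · exact ⟨z, mem_front.2 ⟨hzY, .single hstep⟩, r, r.lt_succ_self,
          Finset.mem_inter.2 ⟨hz, huC⟩⟩
      · obtain ⟨y, hy, k, hk, huk⟩ := ih hzY (Finset.mem_inter.2 ⟨hz, huC⟩) hz
        obtain ⟨hyY, hzy⟩ := mem_front.1 hy
        exact ⟨y, mem_front.2 ⟨hyY, .head hstep hzy⟩, k, hk.trans r.lt_succ_self, huk⟩

/-- The violating items of the largest rank belong to every safe set containing `C`. -/
theorem topViolators_subset (hF : Antimonotonic F) {Y : Finset A} (hCY : C ⊆ Y)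
    (hY : IsSafe F Y) : topViolators F C ⊆ Y := by
  classical
  intro x hxtop
  by_contra hxY
  obtain ⟨hxW, -, hmax⟩ := Finset.mem_filter.1 hxtop
  obtain ⟨hxV, hxF⟩ := Finset.mem_filter.1 hxW
  obtain ⟨hxC, c, hcC, hxc⟩ := mem_neighbours.1 hxV
  have hcfr : c ∈ front F Y x := mem_front.2 ⟨hCY hcC, .single ⟨hxY, hxc⟩⟩
  have hfr : front F Y x ∈ F := front_mem_of_isSafe hF hY hxY ⟨c, hcfr⟩
  obtain ⟨u, hu, hufr⟩ : ∃ u ∈ scan F C (innerLoop F C 1) x, u ∉ front F Y x :=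
    Finset.not_subset.1 fun h => hxF (hF _ hfr _ h)
  have hex : ∃ r, u ∈ scan F C r x := ⟨_, hu⟩
  -- z is where a shortest walk from x to u first enters Y.
  obtain ⟨z, hzfr, k, hk, huz⟩ :=
    exists_mem_front_mem_restrictedNbhd hCY hxY (Nat.find_spec hex)
  -- If z were in C, the walk would end there, so u = z would be in the front.
  have hzC : z ∉ C := by
    intro hzC
    obtain ⟨huz, -⟩ := Finset.mem_inter.1 huz
    rcases Relation.ReflTransGen.cases_head (reaches_of_mem_restrictedNbhd huz) with h | ⟨b, hb, -⟩
    · exact hufr (h ▸ hzfr)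
    · exact hb.1 hzC
  -- A walk from x enters Y at some y of the front after at least one step; the front is a clique,
  -- so z reaches y in at most one.
  have hle : ∀ r, scan F C r x ⊆ scan F C r z := by
    intro r v hv
    obtain ⟨y, hyfr, j, hj, hvy⟩ := exists_mem_front_mem_restrictedNbhd hCY hxY hv
    by_cases hzy : z = y
    · exact scan_mono hj.le (hzy ▸ hvy)
    · obtain ⟨hvj, hvC⟩ := Finset.mem_inter.1 hvy
      exact scan_mono hj (Finset.mem_inter.2 ⟨mem_restrictedNbhd_succ.2
        (Or.inr ⟨y, ⟨hzC, adj_of_mem hF hfr hzfr hyfr hzy⟩, hvj⟩), hvC⟩)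
  have hne : scan F C k x ≠ scan F C k z := fun h => Nat.find_min hex hk (h ▸ huz)
  have hzV : z ∈ neighbours F C := mem_neighbours.2
    ⟨hzC, c, hcC, adj_of_mem hF hfr hzfr hcfr fun h => hzC (h ▸ hcC)⟩
  -- The scan of z contains that of x, so by antimonotonicity it is not in F either.
  have hzW : z ∈ foundViolators F C :=
    Finset.mem_filter.2 ⟨hzV, fun h => hxF (hF _ h _ (hle _))⟩
  exact (rank_lt_rank hxC hzC hle hne).not_ge (hmax ⟨z, hzW, rfl⟩)

theorem subset_safeSearch (F : Finset (Finset A)) (C : Finset A) : C ⊆ safeSearch F C := by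
  induction C using safeSearch.induct F with
  | case1 C h ih => rw [safeSearch, dif_pos h]; exact Finset.subset_union_left.trans ih
  | case2 C h => rw [safeSearch, dif_neg h]

theorem isSafe_safeSearch (hF : Antimonotonic F) (C : Finset A) : IsSafe F (safeSearch F C) := by
  induction C using safeSearch.induct F with
  | case1 C h ih => rwa [safeSearch, dif_pos h]
  | case2 C h =>
    rw [safeSearch, dif_neg h]
    exact isSafe_of_foundViolators_eq_empty hF h

theorem safeSearch_subset (hF : Antimonotonic F) {C Y : Finset A} (hCY : C ⊆ Y)
    (hY : IsSafe F Y) : safeSearch F C ⊆ Y := by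
  induction C using safeSearch.induct F with
  | case1 C h ih =>
    rw [safeSearch, dif_pos h]
    exact ih (Finset.union_subset hCY (topViolators_subset hF hCY hY))
  | case2 C h => rwa [safeSearch, dif_neg h]

end Algorithm

end SafeProjection

theorem mainTheorem6 {A : Type*} [Fintype A] [DecidableEq A] (F : Finset (Finset A))
    (hF : SafeProjection.Antimonotonic F) (B : Finset A) :
    SafeProjection.IsMinimumSafe F B (SafeProjection.safe B F) ∧
      (∀ Y : Finset A, SafeProjection.IsMinimumSafe F B Y → Y = SafeProjection.safe B F) ∧
      ∀ Y : Finset A, B ⊆ Y → SafeProjection.IsSafe F Y → SafeProjection.safe B F ⊆ Y := by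
  have hmin : ∀ Y : Finset A, B ⊆ Y → SafeProjection.IsSafe F Y →
      SafeProjection.safe B F ⊆ Y := fun Y hBY hY => SafeProjection.safeSearch_subset hF hBY hY
  have hB : B ⊆ SafeProjection.safe B F := SafeProjection.subset_safeSearch F B
  have hsafe : SafeProjection.IsSafe F (SafeProjection.safe B F) :=
    SafeProjection.isSafe_safeSearch hF B
  refine ⟨⟨⟨hB, hsafe⟩, fun Y hBY hY => Finset.card_le_card (hmin Y hBY hY)⟩, ?_, hmin⟩
  rintro Y ⟨⟨hBY, hY⟩, hYmin⟩
  exact (Finset.eq_of_subset_of_card_le (hmin Y hBY hY) (hYmin _ hB hsafe)).symm
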